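/- Let $K$ be a field and let $H\subseteq\mathbb{N}$ be a numerical semigroup (a submonoid of $(\mathbb{N},+)$ with finite complement) minimally generated by three integers $n_1,n_2,n_3$ (in any order). Assume that $H$ is not symmetric, where $H$ is called symmetric if for every $x\in\mathbb{Z}$ one has $x\in H$ or $F(H)-x\in H$, with $F(H)$ the largest integer not in $H$. Let $c_1,c_2,c_3$ be the smallest positive integers for which there exist nonnegative integers $a_i,b_i$ ($i=1,2,3$) with $$c_1n_1=b_2n_2+a_3n_3,\qquad c_2n_2=a_1n_1+b_3n_3,\qquad c_3n_3=b_1n_1+a_2n_2,$$ let $a_i,b_i$ be such integers, and set $d_i=\min\{a_i,b_i\}$ for $i=1,2,3$. Let $R=K[H]=K[t^{n_1},t^{n_2},t^{n_3}]\subseteq K[t]$ be the semigroup ring of $H$, let $\omega_R$ be its canonical module (that is, $\omega_R=\operatorname{Ext}^2_S(R,S)$, where $S=K[x_1,x_2,x_3]$ acts on $R$ by $x_i\mapsto t^{n_i}$; the grading plays no role here), let $\operatorname{tr}(\omega_R)=\sum_{\varphi\in\operatorname{Hom}_R(\omega_R,R)}\varphi(\omega_R)$ be the trace ideal of $\omega_R$,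 and let $\operatorname{res}(H)=\dim_K R/\operatorname{tr}(\omega_R)$. Then $$\operatorname{tr}(\omega_R)=(t^{d_1n_1},t^{d_2n_2},t^{d_3n_3})R\qquad\text{and}\qquad \operatorname{res}(H)=d_1d_2d_3 .$$ -/

import Mathlib

universe u

/-! ### The trace of a module -/

/-- The trace of an `R`-module `M`: the sum of the ideals `φ(M)`, where `φ` ranges over
`Hom_R(M, R)`. -/
def moduleTrace (R : Type*) [CommRing R] (M : Type*) [AddCommGroup M] [Module R M] : Ideal R :=
  ⨆ φ : M →ₗ[R] R, LinearMap.range φ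

/-! ### The canonical module of an algebra presented over a polynomial ring -/

/-- The group `Ext^c_S(R, S)` for an `S`-algebra `R`. -/
def ExtDual (S R : Type u) [CommRing S] [CommRing R] [Algebra S R] (c : ℕ) : Type u :=
  CategoryTheory.Abelian.Ext.{u} (ModuleCat.of.{u} S R) (ModuleCat.of.{u} S S) c

namespace ExtDual

variable (S R : Type u) [CommRing S] [CommRing R] [Algebra S R] (c : ℕ)

noncomputable instance : AddCommGroup (ExtDual S R c) :=
  inferInstanceAs (AddCommGroup
    (CategoryTheory.Abelian.Ext.{u} (ModuleCat.of.{u} S R) (ModuleCat.of.{u} S S) c))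

/-- Multiplication by `r : R`, as an endomorphism of the `S`-module `R`. -/
noncomputable def mulEnd (r : R) : ModuleCat.of.{u} S R ⟶ ModuleCat.of.{u} S R :=
  ModuleCat.ofHom (LinearMap.mulLeft S r)

/-- `Ext^c_S(R, S)` is an `R`-module: `r : R` acts through the functoriality of `Ext^c_S(-, S)`
applied to multiplication by `r` on `R`. -/
noncomputable instance : Module R (ExtDual S R c) where
  smul r α := (CategoryTheory.Abelian.Ext.mk₀ (mulEnd S R r)).comp
    (show CategoryTheory.Abelian.Ext.{u} (ModuleCat.of.{u} S R) (ModuleCat.of.{u} S S) c from α)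
    (zero_add c)
  one_smul α := by
    have h : mulEnd S R 1 = CategoryTheory.CategoryStruct.id _ := by
      ext x; simp [mulEnd]
    change (CategoryTheory.Abelian.Ext.mk₀ (mulEnd S R 1)).comp _ _ = _
    rw [h, CategoryTheory.Abelian.Ext.mk₀_id_comp]
  mul_smul r s α := by
    have h : mulEnd S R (r * s) =
        CategoryTheory.CategoryStruct.comp (mulEnd S R r) (mulEnd S R s) := by
      ext x; simp [mulEnd, mul_left_comm]
    change (CategoryTheory.Abelian.Ext.mk₀ (mulEnd S R (r * s))).comp _ _ =
      (CategoryTheory.Abelian.Ext.mk₀ (mulEnd S R r)).comp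
        ((CategoryTheory.Abelian.Ext.mk₀ (mulEnd S R s)).comp _ _) _
    rw [h, CategoryTheory.Abelian.Ext.mk₀_comp_mk₀_assoc]
  smul_zero r := by
    change (CategoryTheory.Abelian.Ext.mk₀ (mulEnd S R r)).comp 0 _ = 0
    exact CategoryTheory.Abelian.Ext.comp_zero ..
  smul_add r α β := CategoryTheory.Abelian.Ext.comp_add ..
  add_smul r s α := by
    have h : mulEnd S R (r + s) = mulEnd S R r + mulEnd S R s := by
      ext x; simp [mulEnd, add_mul]
    change (CategoryTheory.Abelian.Ext.mk₀ (mulEnd S R (r + s))).comp _ _ = _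
    rw [h, CategoryTheory.Abelian.Ext.mk₀_add, CategoryTheory.Abelian.Ext.add_comp]
    rfl
  zero_smul α := by
    have h : mulEnd S R 0 = 0 := by
      ext x; simp [mulEnd]
    change (CategoryTheory.Abelian.Ext.mk₀ (mulEnd S R 0)).comp _ _ = _
    rw [h, CategoryTheory.Abelian.Ext.mk₀_zero, CategoryTheory.Abelian.Ext.zero_comp]
    rfl

end ExtDual

/-! ### Numerical semigroups and their semigroup rings -/

namespace NumSemigroup

/-- The submonoid `⟨n_1, …, n_e⟩` of `ℕ`. -/
def gen {e : ℕ} (n : Fin e → ℕ) : AddSubmonoid ℕ := AddSubmonoid.closure (Set.range n)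

/-- A numerical semigroup: a submonoid of `ℕ` with finitely many gaps. -/
def IsNumerical (H : AddSubmonoid ℕ) : Prop := {x : ℕ | x ∉ H}.Finite

/-- `n_1, …, n_e` is a minimal generating system of the monoid they generate. -/
def IsMinimalGen {e : ℕ} (n : Fin e → ℕ) : Prop :=
  ∀ i, n i ∉ AddSubmonoid.closure (n '' {i}ᶜ)

/-- `H`, seen as a subset of `ℤ`. -/
def toIntSet (H : AddSubmonoid ℕ) : Set ℤ := (fun h : ℕ => (h : ℤ)) '' (H : Set ℕ)

/-- `H` is symmetric: with `F` the Frobenius number (the largest integer outside `H`), for every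
integer `x` one has `x ∈ H` or `F - x ∈ H`. -/
def IsSymmetric (H : AddSubmonoid ℕ) : Prop :=
  ∃ F : ℤ, IsGreatest (toIntSet H)ᶜ F ∧ ∀ x : ℤ, x ∈ toIntSet H ∨ F - x ∈ toIntSet H

/-- The positive integers `c_i` are minimal such that there are nonnegative integers `a_i, b_i`
with `c_1 n_1 = b_2 n_2 + a_3 n_3`, `c_2 n_2 = a_1 n_1 + b_3 n_3`, `c_3 n_3 = b_1 n_1 + a_2 n_2`
(the code counts indices from `0`). -/
structure IsStructureData (n a b c : Fin 3 → ℕ) : Prop where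
  min₁ : IsLeast {m : ℕ | 0 < m ∧ ∃ x y : ℕ, m * n 0 = x * n 1 + y * n 2} (c 0)
  min₂ : IsLeast {m : ℕ | 0 < m ∧ ∃ x y : ℕ, m * n 1 = x * n 0 + y * n 2} (c 1)
  min₃ : IsLeast {m : ℕ | 0 < m ∧ ∃ x y : ℕ, m * n 2 = x * n 0 + y * n 1} (c 2)
  eq₁ : c 0 * n 0 = b 1 * n 1 + a 2 * n 2
  eq₂ : c 1 * n 1 = a 0 * n 0 + b 2 * n 2
  eq₃ : c 2 * n 2 = b 0 * n 0 + a 1 * n 1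

variable (K : Type u) [Field K] {e : ℕ} (n : Fin e → ℕ)

/-- The semigroup ring `K[H] = K[t^{n_1}, …, t^{n_e}] ⊆ K[t]` of `H = ⟨n_1, …, n_e⟩`. -/
noncomputable def semigroupRing : Subalgebra K (Polynomial K) :=
  Algebra.adjoin K (Set.range fun i => (Polynomial.X : Polynomial K) ^ n i)

/-- The generator `t^{n_i}` of `K[H]`. -/
noncomputable def t (i : Fin e) : semigroupRing K n :=
  ⟨Polynomial.X ^ n i, Algebra.subset_adjoin ⟨i, rfl⟩⟩

/-- `K[H]` is an algebra over `S = K[x_1, …, x_e]` through `x_i ↦ t^{n_i}`; the kernel of the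
(surjective) structure map is the defining ideal of `K[H]`. -/
noncomputable instance : Algebra (MvPolynomial (Fin e) K) (semigroupRing K n) :=
  (MvPolynomial.aeval (t K n)).toRingHom.toAlgebra

/-- The canonical module of `K[H]`: the ring `K[H]` is a one-dimensional Cohen-Macaulay quotient
of the polynomial ring `S` in `e` variables, so `ω_{K[H]} = Ext^{e-1}_S(K[H], S)`
(the grading, irrelevant for the trace, is forgotten). -/
abbrev CanonicalModule : Type u := ExtDual (MvPolynomial (Fin e) K) (semigroupRing K n) (e - 1)

/-- The canonical trace ideal `tr(ω_{K[H]})` of `K[H]`. -/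
noncomputable def canonicalTrace : Ideal (semigroupRing K n) :=
  moduleTrace (semigroupRing K n) (CanonicalModule K n)

/-- The residue `res(H) = dim_K K[H] / tr(ω_{K[H]})`. -/
noncomputable def residue : Cardinal.{u} :=
  Module.rank K (semigroupRing K n ⧸ canonicalTrace K n)

end NumSemigroup

/-! Consider the matrix with rows (x₁^a₁, x₂^a₂, x₃^a₃) and (x₂^b₂, x₃^b₃, x₁^b₁). If some a_i or
b_i vanished, two of the c_i n_i would agree (`MinRel.exists_eq`) and H would be symmetric
(`isSymmetric_of_mul_eq`). So all exponents are positive, and then c_i = a_i + b_i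
(`IsStructureData.c_eq`). The maximal minors are now, up to sign, the binomials of the three
structure relations. Rewriting monomials modulo them to unique normal forms shows that they generate
the kernel I of S → R (Herzog's theorem, `IsStructureData.algebraMap_eq_zero_iff`). The
Hilbert-Burch complex 0 → S² → S³ → S → R → 0 is exact, and dualizing it presents ω_R by two
generators with the three columns as relations (`IsStructureData.exists_generators`).

A homomorphism ω_R → R is therefore a pair (U, V) over R annihilated by each column. The first
column alone forces U ∈ (x_i^b_i) and V ∈ (x_i^a_i) in R (`HilbertBurch.exists_of_column_mem`).
Conversely, column j gives the pair (second entry, minus first entry), which is a homomorphism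
because the 2×2 minors vanish in R. Hence the trace is the ideal of all matrix entries, generated by
the t^(d_i n_i). Every minor lies in D = (x_i^d_i), so R / tr(ω_R) = S / D, with basis the d₁d₂d₃
monomials whose exponents are below the d_i. -/

namespace NumSemigroup

/-! ### Minimal relations between three integers -/

/-- `c` is a lower bound for the positive multiples of `n₁` lying in `⟨n₂, n₃⟩`. -/
def MinRel (c n₁ n₂ n₃ : ℕ) : Prop :=
  ∀ m x y : ℕ, 0 < m → m * n₁ = x * n₂ + y * n₃ → c ≤ m

theorem MinRel.swap {c n₁ n₂ n₃ : ℕ} (h : MinRel c n₁ n₂ n₃) : MinRel c n₁ n₃ n₂ :=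
  fun m x y hm e => h m y x hm (by rw [e, add_comm])

/-- If v ≥ c₂, substituting the relation for c₂n₂ into that for c₃n₃ and cancelling z n₃ leaves a
positive multiple (c₃ - z) n₃ in ⟨n₁, n₂⟩, against the minimality of c₃. -/
theorem MinRel.coeff_lt {n₁ n₂ n₃ c₂ c₃ u v w z : ℕ} (m₃ : MinRel c₃ n₃ n₁ n₂)
    (h₃ : c₃ * n₃ = u * n₁ + v * n₂) (h₂ : c₂ * n₂ = w * n₁ + z * n₃)
    (hn₁ : 0 < n₁) (hw : 0 < w) (hz : 0 < z) : v < c₂ := by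
  by_contra hlt
  obtain ⟨k, rfl⟩ := Nat.exists_eq_add_of_le (not_lt.mp hlt)
  have hwn : 0 < w * n₁ := Nat.mul_pos hw hn₁
  have hzc : z < c₃ := by
    by_contra hge
    have := Nat.mul_le_mul_right n₃ (not_lt.mp hge)
    nlinarith [Nat.zero_le (u * n₁), Nat.zero_le (k * n₂)]
  obtain ⟨m, rfl⟩ := Nat.exists_eq_add_of_lt hzc
  have := m₃ (m + 1) (u + w) k (Nat.succ_pos m) (by linarith)
  omega

/-- If one of the three structure relations involves only two generators, then two of the
multiples `c_i n_i` agree. -/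
theorem MinRel.exists_eq {n₁ n₂ n₃ c₁ c₂ c₃ z u v w s : ℕ}
    (m₁ : MinRel c₁ n₁ n₂ n₃) (m₂ : MinRel c₂ n₂ n₁ n₃) (m₃ : MinRel c₃ n₃ n₁ n₂)
    (hn₁ : 0 < n₁) (hn₂ : 0 < n₂) (hn₃ : 0 < n₃) (hc₁ : 0 < c₁) (hc₂ : 0 < c₂) (hc₃ : 0 < c₃)
    (h₁ : c₁ * n₁ = z * n₃) (h₂ : c₂ * n₂ = w * n₁ + s * n₃) (h₃ : c₃ * n₃ = u * n₁ + v * n₂) :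
    c₁ * n₁ = c₃ * n₃ ∨ c₂ * n₂ = c₃ * n₃ ∨ c₁ * n₁ = c₂ * n₂ := by
  have p₁ := Nat.mul_pos hc₁ hn₁
  have p₂ := Nat.mul_pos hc₂ hn₂
  have p₃ := Nat.mul_pos hc₃ hn₃
  have hz : 0 < z := Nat.pos_of_ne_zero (by rintro rfl; omega)
  -- Each comparison is either an equality, and the proof ends, or, after substituting the next
  -- relation, makes a further coefficient vanish. The chain c₁n₁ ≥ c₃n₃ ≥ c₂n₂ ≥ c₁n₁ finally
  -- closes up.
  obtain ⟨k, rfl⟩ := Nat.exists_eq_add_of_le (m₃ z c₁ 0 hz (by linarith))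
  rcases Nat.eq_zero_or_pos k with rfl | hk
  · left; simpa using h₁
  have hkn := Nat.mul_pos hk hn₃
  have huc : u < c₁ := by
    by_contra hge
    have := Nat.mul_le_mul_right n₁ (not_lt.mp hge)
    nlinarith [Nat.zero_le (v * n₂)]
  obtain ⟨m, rfl⟩ := Nat.exists_eq_add_of_lt huc
  have := m₁ (m + 1) v k (Nat.succ_pos m) (by linarith)
  obtain rfl : u = 0 := by omega
  have hv : 0 < v := Nat.pos_of_ne_zero (by rintro rfl; omega)
  obtain ⟨l, rfl⟩ := Nat.exists_eq_add_of_le (m₂ v 0 c₃ hv (by linarith))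
  rcases Nat.eq_zero_or_pos l with rfl | hl
  · right; left; linarith
  have hln := Nat.mul_pos hl hn₂
  have hsc : s < c₃ := by
    by_contra hge
    have := Nat.mul_le_mul_right n₃ (not_lt.mp hge)
    nlinarith [Nat.zero_le (w * n₁)]
  obtain ⟨j, rfl⟩ := Nat.exists_eq_add_of_lt hsc
  have := m₃ (j + 1) w l (Nat.succ_pos j) (by linarith)
  obtain rfl : s = 0 := by omega
  have hw : 0 < w := Nat.pos_of_ne_zero (by rintro rfl; omega)
  have hw' := Nat.mul_le_mul_right n₁ (m₁ w c₂ 0 hw (by linarith))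
  right; right
  linarith

/-! ### A criterion for symmetry -/

theorem mem_toIntSet_natCast {H : AddSubmonoid ℕ} {x : ℕ} : (x : ℤ) ∈ toIntSet H ↔ x ∈ H := by
  simp [toIntSet]

theorem IsNumerical.exists_int_combination {H : AddSubmonoid ℕ} {n₁ n₂ n₃ : ℕ}
    (hnum : IsNumerical H) (hH : ∀ x, x ∈ H → ∃ p q r : ℕ, x = p * n₁ + q * n₂ + r * n₃) (x : ℤ) :
    ∃ p q r : ℤ, x = p * n₁ + q * n₂ + r * n₃ := by
  obtain ⟨N, hN⟩ := hnum.bddAbove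
  have hmem : ∀ m, N < m → m ∈ H := fun m hm => by
    by_contra hc
    exact absurd (hN hc) (not_le.mpr hm)
  -- Two consecutive elements of H differ by 1, so x times their difference is x.
  obtain ⟨p, q, r, e⟩ := hH _ (hmem (N + 1) (by omega))
  obtain ⟨p', q', r', e'⟩ := hH _ (hmem (N + 2) (by omega))
  refine ⟨x * (p' - p), x * (q' - q), x * (r' - r), ?_⟩
  have h1 : (N : ℤ) + 1 = p * n₁ + q * n₂ + r * n₃ := by exact_mod_cast e
  have h2 : (N : ℤ) + 2 = p' * n₁ + q' * n₂ + r' * n₃ := by exact_mod_cast e'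
  linear_combination x * (h2 - h1)

/-- If `c₁ n₁ = c₃ n₃` and `c₂ n₂ ∈ ⟨n₁, n₃⟩`, every integer combination can be brought to a form
with the first two coefficients reduced. -/
theorem exists_reduced {n₁ n₂ n₃ c₁ c₂ c₃ w s : ℕ} (hc₁ : 0 < c₁) (hc₂ : 0 < c₂)
    (h₁ : c₁ * n₁ = c₃ * n₃) (h₂ : c₂ * n₂ = w * n₁ + s * n₃) (X Y Z : ℤ) :
    ∃ (p q : ℕ) (r : ℤ), p < c₁ ∧ q < c₂ ∧
      X * n₁ + Y * n₂ + Z * n₃ = p * n₁ + q * n₂ + r * n₃ ∧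
      (0 ≤ X → 0 ≤ Y → 0 ≤ Z → 0 ≤ r) := by
  have hc₁' : (0 : ℤ) < c₁ := by exact_mod_cast hc₁
  have hc₂' : (0 : ℤ) < c₂ := by exact_mod_cast hc₂
  have e₁ : (c₁ : ℤ) * n₁ = c₃ * n₃ := by exact_mod_cast h₁
  have e₂ : (c₂ : ℤ) * n₂ = w * n₁ + s * n₃ := by exact_mod_cast h₂
  set k := Y / c₂
  set X' := X + k * w with hX'
  set l := X' / c₁
  have hq0 := Int.emod_nonneg Y hc₂'.ne'
  have hp0 := Int.emod_nonneg X' hc₁'.ne'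
  have hq := Int.emod_lt_of_pos Y hc₂'
  have hp := Int.emod_lt_of_pos X' hc₁'
  have hY : Y % c₂ + c₂ * k = Y := Int.emod_add_mul_ediv Y c₂
  have hX : X' % c₁ + c₁ * l = X' := Int.emod_add_mul_ediv X' c₁
  refine ⟨(X' % c₁).toNat, (Y % c₂).toNat, Z + k * s + l * c₃, by omega, by omega, ?_, ?_⟩
  · rw [Int.toNat_of_nonneg hq0, Int.toNat_of_nonneg hp0]
    linear_combination (-(n₂ : ℤ)) * hY - (n₁ : ℤ) * hX + k * e₂ + l * e₁ - n₁ * hX'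
  · intro hX0 hY0 hZ0
    have hk : 0 ≤ k := Int.ediv_nonneg hY0 hc₂'.le
    have hl : 0 ≤ l := Int.ediv_nonneg (by positivity) hc₁'.le
    positivity

/-- Every integer is p n₁ + q n₂ + r n₃ with 0 ≤ p < c₁, 0 ≤ q < c₂ and r of any sign. The
reflection (p, q, r) ↦ (c₁-1-p, c₂-1-q, -1-r) sends x to F - x, and one of r, -1-r is nonnegative.
-/
theorem isSymmetric_of_mul_eq {H : AddSubmonoid ℕ} {n₁ n₂ n₃ c₁ c₂ c₃ w s : ℕ}
    (hnum : IsNumerical H) (hH : ∀ x, x ∈ H ↔ ∃ p q r : ℕ, x = p * n₁ + q * n₂ + r * n₃)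
    (m₁ : MinRel c₁ n₁ n₂ n₃) (m₂ : MinRel c₂ n₂ n₁ n₃) (m₃ : MinRel c₃ n₃ n₁ n₂)
    (hn₃ : 0 < n₃) (hc₁ : 0 < c₁) (hc₂ : 0 < c₂)
    (h₁ : c₁ * n₁ = c₃ * n₃) (h₂ : c₂ * n₂ = w * n₁ + s * n₃) : IsSymmetric H := by
  set F : ℤ := (c₁ - 1) * n₁ + (c₂ - 1) * n₂ - n₃ with hF
  have hmem : ∀ (p q : ℕ) (r : ℤ), 0 ≤ r → (p * n₁ + q * n₂ + r * n₃ : ℤ) ∈ toIntSet H := by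
    intro p q r hr
    lift r to ℕ using hr
    have := mem_toIntSet_natCast.mpr ((hH _).mpr ⟨p, q, r, rfl⟩)
    exact_mod_cast this
  have hdich : ∀ x : ℤ, x ∈ toIntSet H ∨ F - x ∈ toIntSet H := by
    intro x
    obtain ⟨X, Y, Z, rfl⟩ := hnum.exists_int_combination (fun x => (hH x).mp) x
    obtain ⟨p, q, r, hp, hq, e, -⟩ := exists_reduced hc₁ hc₂ h₁ h₂ X Y Z
    rw [e]
    rcases le_or_gt 0 r with hr | hr
    · exact Or.inl (hmem p q r hr)
    · right
      convert hmem (c₁ - 1 - p) (c₂ - 1 - q) (-1 - r) (by omega) using 1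
      rw [Nat.sub_sub, Nat.sub_sub, Nat.cast_sub (by omega), Nat.cast_sub (by omega), hF]
      push_cast
      ring
  refine ⟨F, ⟨?_, ?_⟩, hdich⟩
  · rintro ⟨h, hh, e⟩
    obtain ⟨P, Q, R, rfl⟩ := (hH h).mp hh
    obtain ⟨p, q, r, hp, hq, e', hr⟩ := exists_reduced hc₁ hc₂ h₁ h₂ P Q R
    have hr := hr (by positivity) (by positivity) (by positivity)
    lift r to ℕ using hr
    obtain ⟨A, rfl⟩ := Nat.exists_eq_add_of_lt hp
    obtain ⟨B, rfl⟩ := Nat.exists_eq_add_of_lt hq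
    -- Here A = c₁-1-p and B = c₂-1-q, so F ∈ H yields a relation with A < c₁ and B < c₂. Trading
    -- c₃n₃ for c₁n₁ contradicts the minimality of c₂, or that of c₁ when B = 0 < A.
    have key : (r + 1) * n₃ = A * n₁ + B * n₂ := by
      zify
      push_cast at e e' hF
      linear_combination e + hF - e'
    obtain ⟨k, hk⟩ := Nat.exists_eq_add_of_le (m₃ _ _ _ (Nat.succ_pos r) key)
    have key' : (p + 1) * n₁ + k * n₃ = B * n₂ := by
      zify at key h₁ hk ⊢
      linear_combination h₁ + key - n₃ * hk
    rcases Nat.eq_zero_or_pos B with rfl | hB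
    · rcases Nat.eq_zero_or_pos A with rfl | hA
      · simp at key
        omega
      · have := m₁ A 0 (r + 1) hA (by linarith)
        omega
    · have := m₂ B (p + 1) k hB key'.symm
      omega
  · intro x hx
    rcases hdich x with h | ⟨y, -, hy⟩
    · exact absurd h hx
    · have : (0 : ℤ) ≤ F - x := hy ▸ Int.natCast_nonneg y
      linarith

/-! ### Normal forms for the relations of Herzog -/

/-- Exponent triples that are reduced with respect to `x^c₁ → y^b₂ z^a₃`, `y^c₂ → x^a₁ z^b₃`,
`x^b₁ y^a₂ → z^c₃`. -/
def IsReduced (c₁ c₂ b₁ a₂ p q : ℕ) : Prop := p < c₁ ∧ q < c₂ ∧ ¬ (b₁ ≤ p ∧ a₂ ≤ q)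

/-- Each of the three rewriting rules preserves the total weight and strictly lowers the share p n₁
+ q n₂ carried by x and y, so rewriting terminates. The ring is arbitrary so that the lemma applies
to S modulo the minors. -/
theorem exists_isReduced {Q : Type*} [CommRing Q] {x y z : Q}
    {n₁ n₂ n₃ c₁ c₂ c₃ a₁ a₂ a₃ b₁ b₂ b₃ : ℕ} (hn₁ : 0 < n₁) (hn₃ : 0 < n₃)
    (ha₃ : 0 < a₃) (hb₁ : 0 < b₁) (hb₃ : 0 < b₃)
    (h₁ : c₁ * n₁ = b₂ * n₂ + a₃ * n₃) (h₂ : c₂ * n₂ = a₁ * n₁ + b₃ * n₃)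
    (h₃ : c₃ * n₃ = b₁ * n₁ + a₂ * n₂)
    (r₁ : x ^ c₁ = y ^ b₂ * z ^ a₃) (r₂ : y ^ c₂ = x ^ a₁ * z ^ b₃)
    (r₃ : z ^ c₃ = x ^ b₁ * y ^ a₂) (N p q r : ℕ) (hN : p * n₁ + q * n₂ ≤ N) :
    ∃ p' q' r' : ℕ, IsReduced c₁ c₂ b₁ a₂ p' q' ∧
      p * n₁ + q * n₂ + r * n₃ = p' * n₁ + q' * n₂ + r' * n₃ ∧
      x ^ p * y ^ q * z ^ r = x ^ p' * y ^ q' * z ^ r' := by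
  induction N using Nat.strong_induction_on generalizing p q r with
  | _ N ih =>
  by_cases hp : c₁ ≤ p
  · obtain ⟨k, rfl⟩ := Nat.exists_eq_add_of_le hp
    have := Nat.mul_pos ha₃ hn₃
    obtain ⟨p', q', r', hred, hw, he⟩ := ih (k * n₁ + (q + b₂) * n₂) (by linarith) k (q + b₂)
      (r + a₃) le_rfl
    refine ⟨p', q', r', hred, by linarith, ?_⟩
    rw [← he, pow_add, r₁]
    ring
  by_cases hq : c₂ ≤ q
  · obtain ⟨k, rfl⟩ := Nat.exists_eq_add_of_le hq
    have := Nat.mul_pos hb₃ hn₃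
    obtain ⟨p', q', r', hred, hw, he⟩ := ih ((p + a₁) * n₁ + k * n₂) (by linarith) (p + a₁) k
      (r + b₃) le_rfl
    refine ⟨p', q', r', hred, by linarith, ?_⟩
    rw [← he, pow_add y, r₂]
    ring
  by_cases hpq : b₁ ≤ p ∧ a₂ ≤ q
  · obtain ⟨k, rfl⟩ := Nat.exists_eq_add_of_le hpq.1
    obtain ⟨l, rfl⟩ := Nat.exists_eq_add_of_le hpq.2
    have := Nat.mul_pos hb₁ hn₁
    obtain ⟨p', q', r', hred, hw, he⟩ := ih (k * n₁ + l * n₂) (by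
      nlinarith [Nat.zero_le (a₂ * n₂)]) k l (r + c₃) le_rfl
    refine ⟨p', q', r', hred, by linarith, ?_⟩
    rw [← he, pow_add z, r₃]
    ring
  · exact ⟨p, q, r, ⟨not_le.mp hp, not_le.mp hq, hpq⟩, rfl, rfl⟩

theorem eq_zero_of_combination_eq_zero {n₁ n₂ n₃ p q r : ℕ} (hn₁ : 0 < n₁) (hn₂ : 0 < n₂)
    (hn₃ : 0 < n₃) (h : p * n₁ + q * n₂ + r * n₃ = 0) : p = 0 ∧ q = 0 ∧ r = 0 := by
  simpa [Nat.add_eq_zero_iff, hn₁.ne', hn₂.ne', hn₃.ne', and_assoc] using h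

/-- Cancelling common parts leaves a relation between disjoint sets of generators. If n₁ or n₂
stands alone on one side, its coefficient is below c₁ or c₂. If n₃ stands alone, its coefficient is
at least c₃, and comparing with c₃n₃ = b₁n₁ + a₂n₂ contradicts reducedness or again minimality. -/
theorem IsReduced.eq_of_weight_eq {n₁ n₂ n₃ c₁ c₂ c₃ a₂ b₁ : ℕ}
    (hn₁ : 0 < n₁) (hn₂ : 0 < n₂) (hn₃ : 0 < n₃)
    (m₁ : MinRel c₁ n₁ n₂ n₃) (m₂ : MinRel c₂ n₂ n₁ n₃) (m₃ : MinRel c₃ n₃ n₁ n₂)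
    (h₃ : c₃ * n₃ = b₁ * n₁ + a₂ * n₂) {p q r p' q' r' : ℕ}
    (hred : IsReduced c₁ c₂ b₁ a₂ p q) (hred' : IsReduced c₁ c₂ b₁ a₂ p' q')
    (hw : p * n₁ + q * n₂ + r * n₃ = p' * n₁ + q' * n₂ + r' * n₃) :
    p = p' ∧ q = q' ∧ r = r' := by
  wlog hr : r' ≤ r generalizing p q r p' q' r'
  · obtain ⟨e₁, e₂, e₃⟩ := this hred' hred hw.symm (by omega)
    exact ⟨e₁.symm, e₂.symm, e₃.symm⟩
  obtain ⟨hp, hq, hpq⟩ := hred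
  obtain ⟨hp', hq', hpq'⟩ := hred'
  obtain ⟨k, rfl⟩ := Nat.exists_eq_add_of_le hr
  rcases le_total p p' with hpp | hpp <;> obtain ⟨P, rfl⟩ := Nat.exists_eq_add_of_le hpp <;>
    rcases le_total q q' with hqq | hqq <;> obtain ⟨Q, rfl⟩ := Nat.exists_eq_add_of_le hqq
  · have e : k * n₃ = P * n₁ + Q * n₂ := by zify at hw ⊢; linear_combination hw
    rcases Nat.eq_zero_or_pos k with rfl | hk
    · obtain ⟨rfl, rfl, -⟩ := eq_zero_of_combination_eq_zero (p := P) (q := Q) (r := 0) hn₁ hn₂ hn₃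
        (by linarith)
      simp
    exfalso
    obtain ⟨l, rfl⟩ := Nat.exists_eq_add_of_le (m₃ k P Q hk e)
    by_cases hP : b₁ ≤ P
    · have hQ : Q < a₂ := by
        by_contra hc
        exact hpq' ⟨by omega, by omega⟩
      obtain ⟨j, rfl⟩ := Nat.exists_eq_add_of_lt hQ
      obtain ⟨i, rfl⟩ := Nat.exists_eq_add_of_le hP
      have e' : i * n₁ = (j + 1) * n₂ + l * n₃ := by zify at e h₃ ⊢; linear_combination h₃ - e
      have hi : 0 < i := Nat.pos_of_ne_zero (by
        rintro rfl
        have := eq_zero_of_combination_eq_zero (p := 0) (q := j + 1) (r := l) hn₁ hn₂ hn₃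
          (by linarith)
        omega)
      have := m₁ i (j + 1) l hi e'
      omega
    · obtain ⟨j, rfl⟩ := Nat.exists_eq_add_of_lt (not_le.mp hP)
      have hQ : a₂ < Q := by
        by_contra hc
        obtain ⟨i, rfl⟩ := Nat.exists_eq_add_of_le (not_lt.mp hc)
        have := eq_zero_of_combination_eq_zero (p := j + 1) (q := i) (r := l) hn₁ hn₂ hn₃
          (by zify at e h₃ ⊢; linear_combination e - h₃)
        omega
      obtain ⟨i, rfl⟩ := Nat.exists_eq_add_of_lt hQ
      have := m₂ (i + 1) (j + 1) l (Nat.succ_pos i) (by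
        zify at e h₃ ⊢; linear_combination h₃ - e)
      omega
  · rcases Nat.eq_zero_or_pos P with rfl | hP
    · obtain ⟨-, rfl, rfl⟩ := eq_zero_of_combination_eq_zero (p := 0) (q := Q) (r := k) hn₁ hn₂ hn₃
        (by zify at hw ⊢; linear_combination hw)
      simp
    · have := m₁ P Q k hP (by zify at hw ⊢; linear_combination -hw)
      omega
  · rcases Nat.eq_zero_or_pos Q with rfl | hQ
    · obtain ⟨rfl, -, rfl⟩ := eq_zero_of_combination_eq_zero (p := P) (q := 0) (r := k) hn₁ hn₂ hn₃
        (by zify at hw ⊢; linear_combination hw)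
      simp
    · have := m₂ Q P k hQ (by zify at hw ⊢; linear_combination -hw)
      omega
  · obtain ⟨rfl, rfl, rfl⟩ := eq_zero_of_combination_eq_zero (p := P) (q := Q) (r := k) hn₁ hn₂ hn₃
      (by zify at hw ⊢; linear_combination hw)
    simp

/-! ### The structure data of a non-symmetric semigroup -/

theorem mem_gen_three {n : Fin 3 → ℕ} {x : ℕ} :
    x ∈ gen n ↔ ∃ p q r : ℕ, x = p * n 0 + q * n 1 + r * n 2 := by
  rw [gen, AddSubmonoid.mem_closure_range_iff_of_fintype]
  constructor
  · rintro ⟨a, rfl⟩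
    exact ⟨a 0, a 1, a 2, by simp [Fin.sum_univ_three]⟩
  · rintro ⟨p, q, r, rfl⟩
    exact ⟨![p, q, r], by simp [Fin.sum_univ_three]⟩

theorem IsMinimalGen.pos {e : ℕ} {n : Fin e → ℕ} (h : IsMinimalGen n) (i : Fin e) : 0 < n i :=
  Nat.pos_of_ne_zero fun h0 => h i (h0 ▸ zero_mem _)

section

variable {n a b c : Fin 3 → ℕ}

theorem IsStructureData.minRel₁ (h : IsStructureData n a b c) : MinRel (c 0) (n 0) (n 1) (n 2) :=
  fun _ x y hm e => h.min₁.2 ⟨hm, x, y, e⟩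

theorem IsStructureData.minRel₂ (h : IsStructureData n a b c) : MinRel (c 1) (n 1) (n 0) (n 2) :=
  fun _ x y hm e => h.min₂.2 ⟨hm, x, y, e⟩

theorem IsStructureData.minRel₃ (h : IsStructureData n a b c) : MinRel (c 2) (n 2) (n 0) (n 1) :=
  fun _ x y hm e => h.min₃.2 ⟨hm, x, y, e⟩

theorem IsStructureData.c_pos (h : IsStructureData n a b c) (i : Fin 3) : 0 < c i := by
  fin_cases i
  exacts [h.min₁.1.1, h.min₂.1.1, h.min₃.1.1]

theorem IsStructureData.isSymmetric_of_mul_eq (h : IsStructureData n a b c)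
    (hnum : IsNumerical (gen n)) (hn : ∀ i, 0 < n i)
    (he : c 0 * n 0 = c 2 * n 2 ∨ c 1 * n 1 = c 2 * n 2 ∨ c 0 * n 0 = c 1 * n 1) :
    IsSymmetric (gen n) := by
  rcases he with he | he | he
  · exact NumSemigroup.isSymmetric_of_mul_eq hnum (fun _ => mem_gen_three)
      h.minRel₁ h.minRel₂ h.minRel₃ (hn 2) (h.c_pos 0) (h.c_pos 1) he h.eq₂
  · refine NumSemigroup.isSymmetric_of_mul_eq hnum (fun _ => mem_gen_three.trans ?_)
      h.minRel₂ h.minRel₁ h.minRel₃.swap (hn 2) (h.c_pos 1) (h.c_pos 0) he h.eq₁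
    exact ⟨fun ⟨p, q, r, e⟩ => ⟨q, p, r, by linarith⟩, fun ⟨p, q, r, e⟩ => ⟨q, p, r, by linarith⟩⟩
  · refine NumSemigroup.isSymmetric_of_mul_eq hnum (fun _ => mem_gen_three.trans ?_)
      h.minRel₁.swap h.minRel₃ h.minRel₂ (hn 1) (h.c_pos 0) (h.c_pos 2) he h.eq₃
    exact ⟨fun ⟨p, q, r, e⟩ => ⟨p, r, q, by linarith⟩, fun ⟨p, q, r, e⟩ => ⟨p, r, q, by linarith⟩⟩

/-- A vanishing coefficient is, up to permuting the generators, the hypothesis of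
`MinRel.exists_eq`; the resulting equality makes H symmetric. -/
theorem IsStructureData.pos (h : IsStructureData n a b c) (hnum : IsNumerical (gen n))
    (hn : ∀ i, 0 < n i) (hns : ¬ IsSymmetric (gen n)) : (∀ i, 0 < a i) ∧ ∀ i, 0 < b i := by
  have key : ¬ (c 0 * n 0 = c 2 * n 2 ∨ c 1 * n 1 = c 2 * n 2 ∨ c 0 * n 0 = c 1 * n 1) :=
    fun he => hns (h.isSymmetric_of_mul_eq hnum hn he)
  have m₁ := h.minRel₁
  have m₂ := h.minRel₂
  have m₃ := h.minRel₃
  have hc := h.c_pos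
  have e₁ := h.eq₁
  have e₂ := h.eq₂
  have e₃ := h.eq₃
  refine ⟨fun i => Nat.pos_of_ne_zero fun h0 => ?_, fun i => Nat.pos_of_ne_zero fun h0 => ?_⟩ <;>
    fin_cases i <;> simp only [Fin.zero_eta, Fin.mk_one, Fin.reduceFinMk] at h0 <;>
    simp only [h0, zero_mul, zero_add, add_zero] at e₁ e₂ e₃
  · have := MinRel.exists_eq m₂ m₁ m₃.swap (hn 1) (hn 0) (hn 2) (hc 1) (hc 0) (hc 2)
      (z := b 2) (w := b 1) (s := a 2) (u := a 1) (v := b 0) (by linarith) (by linarith)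
      (by linarith)
    omega
  · have := MinRel.exists_eq m₃.swap m₂.swap m₁.swap (hn 2) (hn 1) (hn 0) (hc 2) (hc 1) (hc 0)
      (z := b 0) (w := b 2) (s := a 0) (u := a 2) (v := b 1) (by linarith) (by linarith)
      (by linarith)
    omega
  · have := MinRel.exists_eq m₁.swap m₃ m₂ (hn 0) (hn 2) (hn 1) (hc 0) (hc 2) (hc 1)
      (z := b 1) (w := b 0) (s := a 1) (u := a 0) (v := b 2) (by linarith) (by linarith)
      (by linarith)
    omega
  · have := MinRel.exists_eq m₃ m₁.swap m₂.swap (hn 2) (hn 0) (hn 1) (hc 2) (hc 0) (hc 1)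
      (z := a 1) (w := a 2) (s := b 1) (u := b 2) (v := a 0) (by linarith) (by linarith)
      (by linarith)
    omega
  · have := MinRel.exists_eq m₁ m₂ m₃ (hn 0) (hn 1) (hn 2) (hc 0) (hc 1) (hc 2)
      (z := a 2) (w := a 0) (s := b 2) (u := b 0) (v := a 1) (by linarith) (by linarith)
      (by linarith)
    omega
  · have := MinRel.exists_eq m₂.swap m₃.swap m₁ (hn 1) (hn 2) (hn 0) (hc 1) (hc 2) (hc 0)
      (z := a 0) (w := a 1) (s := b 0) (u := b 1) (v := a 2) (by linarith) (by linarith)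
      (by linarith)
    omega

/-- Adding two structure relations exhibits (a_i + b_i) n_i in the span of the other two generators,
so c_i ≤ a_i + b_i. Adding all three gives Σ c_i n_i = Σ (a_i + b_i) n_i, which forces equality
throughout. -/
theorem IsStructureData.c_eq (h : IsStructureData n a b c) (hn : ∀ i, 0 < n i)
    (ha : ∀ i, 0 < a i) (hb : ∀ i, 0 < b i) (i : Fin 3) : c i = a i + b i := by
  have m₁ := h.minRel₁
  have m₂ := h.minRel₂
  have m₃ := h.minRel₃
  have e₁ := h.eq₁
  have e₂ := h.eq₂
  have e₃ := h.eq₃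
  have a₁ : a 0 < c 0 := m₂.swap.coeff_lt (u := b 2) (v := a 0) (w := a 2) (z := b 1)
    (by linarith) (by linarith) (hn 2) (ha 2) (hb 1)
  have b₁ : b 0 < c 0 := m₃.swap.coeff_lt (u := a 1) (v := b 0) (w := b 1) (z := a 2)
    (by linarith) (by linarith) (hn 1) (hb 1) (ha 2)
  have a₂ : a 1 < c 1 := m₃.coeff_lt (u := b 0) (v := a 1) (w := a 0) (z := b 2)
    (by linarith) (by linarith) (hn 0) (ha 0) (hb 2)
  have b₂ : b 1 < c 1 := m₁.swap.coeff_lt (u := a 2) (v := b 1) (w := b 2) (z := a 0)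
    (by linarith) (by linarith) (hn 2) (hb 2) (ha 0)
  have a₃ : a 2 < c 2 := m₁.coeff_lt (u := b 1) (v := a 2) (w := a 1) (z := b 0)
    (by linarith) (by linarith) (hn 1) (ha 1) (hb 0)
  have b₃ : b 2 < c 2 := m₂.coeff_lt (u := a 0) (v := b 2) (w := b 0) (z := a 1)
    (by linarith) (by linarith) (hn 0) (hb 0) (ha 1)
  have l₁ : c 0 ≤ a 0 + b 0 := m₁ _ (c 1 - a 1) (c 2 - b 2) (by have := ha 0; omega) (by
    zify [a₂.le, b₃.le]; zify at e₂ e₃; linear_combination -e₂ - e₃)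
  have l₂ : c 1 ≤ a 1 + b 1 := m₂ _ (c 0 - b 0) (c 2 - a 2) (by have := ha 1; omega) (by
    zify [b₁.le, a₃.le]; zify at e₁ e₃; linear_combination -e₁ - e₃)
  have l₃ : c 2 ≤ a 2 + b 2 := m₃ _ (c 0 - a 0) (c 1 - b 1) (by have := ha 2; omega) (by
    zify [a₁.le, b₂.le]; zify at e₁ e₂; linear_combination -e₁ - e₂)
  obtain ⟨k₁, hk₁⟩ := Nat.exists_eq_add_of_le l₁
  obtain ⟨k₂, hk₂⟩ := Nat.exists_eq_add_of_le l₂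
  obtain ⟨k₃, hk₃⟩ := Nat.exists_eq_add_of_le l₃
  have key : k₁ * n 0 + k₂ * n 1 + k₃ * n 2 = 0 := by
    zify at *
    linear_combination -(n 0 : ℤ) * hk₁ - (n 1 : ℤ) * hk₂ - (n 2 : ℤ) * hk₃ - e₁ - e₂ - e₃
  have := (hn 0).ne'
  have := (hn 1).ne'
  have := (hn 2).ne'
  simp_all only [Nat.add_eq_zero_iff, Nat.mul_eq_zero, or_false]
  fin_cases i <;> simp <;> omega

end

end NumSemigroup

/-! ### Ext² from a length-two projective resolution -/

namespace ExtDual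

open CategoryTheory CategoryTheory.Abelian

variable {S R : Type u} [CommRing S] [CommRing R] [Algebra S R]

/-- Reconciles the R-action, defined by functoriality in the first argument, with the S-linear
structure on Ext. -/
theorem mk₀_mulEnd_comp (s : S) (c : ℕ)
    (α : Ext.{u} (ModuleCat.of.{u} S R) (ModuleCat.of.{u} S S) c) :
    (Ext.mk₀ (mulEnd S R (algebraMap S R s))).comp α (zero_add c) = s • α := by
  have h : mulEnd S R (algebraMap S R s) = s • 𝟙 (ModuleCat.of.{u} S R) := by
    ext x
    simp [mulEnd, Algebra.smul_def]
  rw [h, Ext.mk₀_smul, Ext.smul_comp, Ext.mk₀_id_comp]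

/-- If `0 → F₂ → F₁ → S → R → 0` is a projective resolution of length two of the `S`-algebra `R`,
then `Ext²_S(R, S)` is the cokernel of `Hom_S(F₁, S) → Hom_S(F₂, S)`. -/
theorem exists_presentation {F₁ F₂ : Type u} [AddCommGroup F₁] [Module S F₁] [AddCommGroup F₂]
    [Module S F₂] [Module.Projective S F₁] (f : F₂ →ₗ[S] F₁) (g : F₁ →ₗ[S] S)
    (hf : Function.Injective f) (hfg : Function.Exact f g)
    (hg : ∀ s, algebraMap S R s = 0 ↔ s ∈ LinearMap.range g)
    (hsurj : Function.Surjective (algebraMap S R)) :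
    ∃ Ψ : (F₂ →ₗ[S] S) →+ ExtDual S R 2, Function.Surjective Ψ ∧
      (∀ s φ, Ψ (s • φ) = algebraMap S R s • Ψ φ) ∧
      ∀ φ, Ψ φ = 0 ↔ ∃ ψ : F₁ →ₗ[S] S, φ = ψ ∘ₗ f := by
  let N : Submodule S S := LinearMap.range g
  let T : ShortComplex (ModuleCat.{u} S) := ShortComplex.mk (X₁ := ModuleCat.of.{u} S N)
    (X₂ := ModuleCat.of.{u} S S) (X₃ := ModuleCat.of.{u} S R)
    (ModuleCat.ofHom N.subtype) (ModuleCat.ofHom (Algebra.linearMap S R)) (by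
      ext x
      exact (hg _).mpr x.2)
  have hT : T.ShortExact :=
    { exact := (ShortComplex.ShortExact.moduleCat_exact_iff_function_exact T).mpr fun s =>
        (hg s).trans ⟨fun h => ⟨⟨s, h⟩, rfl⟩, fun ⟨x, hx⟩ => hx ▸ x.2⟩
      mono_f := (ModuleCat.mono_iff_injective _).mpr N.injective_subtype
      epi_g := (ModuleCat.epi_iff_surjective _).mpr hsurj }
  let U : ShortComplex (ModuleCat.{u} S) := ShortComplex.mk (X₁ := ModuleCat.of.{u} S F₂)
    (X₂ := ModuleCat.of.{u} S F₁) (X₃ := ModuleCat.of.{u} S N)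
    (ModuleCat.ofHom f) (ModuleCat.ofHom g.rangeRestrict) (by
      ext x
      exact hfg.apply_apply_eq_zero x)
  have hU : U.ShortExact :=
    { exact := (ShortComplex.ShortExact.moduleCat_exact_iff_function_exact U).mpr fun x =>
        Subtype.ext_iff.trans (hfg x)
      mono_f := (ModuleCat.mono_iff_injective _).mpr hf
      epi_g := (ModuleCat.epi_iff_surjective _).mpr g.surjective_rangeRestrict }
  have : Projective T.X₂ := inferInstanceAs (Projective (ModuleCat.of.{u} S S))
  have : Projective U.X₂ := inferInstanceAs (Projective (ModuleCat.of.{u} S F₁))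
  let Y : ModuleCat.{u} S := ModuleCat.of.{u} S S
  -- Dimension shifting: the composite of the connecting maps Hom(F₂, S) → Ext¹(N, S) → Ext²(R, S)
  -- of the two short exact sequences. Their middle terms are projective, which gives surjectivity
  -- and the kernel.
  let Ψ : (F₂ →ₗ[S] S) → Ext.{u} (ModuleCat.of.{u} S R) Y 2 := fun φ =>
    hT.extClass.comp (hU.extClass.comp (Ext.mk₀ (ModuleCat.ofHom φ : U.X₁ ⟶ Y)) (add_zero 1))
      (by norm_num : 1 + 1 = 2)
  have hsmul : ∀ (s : S) φ, Ψ (s • φ) = s • Ψ φ := by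
    intro s φ
    have : (ModuleCat.ofHom (s • φ) : U.X₁ ⟶ Y) = s • (ModuleCat.ofHom φ : U.X₁ ⟶ Y) := rfl
    simp only [Ψ, this, Ext.mk₀_smul, Ext.comp_smul]
  refine ⟨AddMonoidHom.mk' Ψ fun φ φ' => ?_, fun α => ?_, fun s φ => ?_, fun φ => ⟨fun h => ?_, ?_⟩⟩
  · have : (ModuleCat.ofHom (φ + φ') : U.X₁ ⟶ Y) =
      (ModuleCat.ofHom φ : U.X₁ ⟶ Y) + (ModuleCat.ofHom φ' : U.X₁ ⟶ Y) := rfl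
    change Ψ (φ + φ') = Ψ φ + Ψ φ'
    simp only [Ψ, this, Ext.mk₀_add, Ext.comp_add]
  · obtain ⟨β, hβ⟩ := Ext.contravariant_sequence_exact₃ hT Y α (Ext.eq_zero_of_projective _)
      (by norm_num : 1 + 1 = 2)
    obtain ⟨γ, hγ⟩ := Ext.contravariant_sequence_exact₃ hU Y β (Ext.eq_zero_of_projective _)
      (add_zero 1)
    obtain ⟨φ, rfl⟩ := Ext.addEquiv₀.symm.surjective γ
    exact ⟨ModuleCat.Hom.hom φ, by rw [← hβ, ← hγ]; rfl⟩
  · exact (hsmul s φ).trans (mk₀_mulEnd_comp s 2 (Ψ φ)).symm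
  · obtain ⟨x, hx⟩ := Ext.contravariant_sequence_exact₁ hT Y _ (by norm_num : 1 + 1 = 2) h
    rw [Ext.eq_zero_of_projective x, Ext.comp_zero] at hx
    obtain ⟨y, hy⟩ := Ext.contravariant_sequence_exact₁ hU Y _ (add_zero 1) hx.symm
    obtain ⟨ψ, rfl⟩ := Ext.addEquiv₀.symm.surjective y
    refine ⟨ModuleCat.Hom.hom ψ, ?_⟩
    have hy' : Ext.mk₀ (U.f ≫ ψ) = Ext.mk₀ (ModuleCat.ofHom φ : U.X₁ ⟶ Y) := by
      rw [← hy, ← Ext.mk₀_comp_mk₀]; rfl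
    have := Ext.addEquiv₀.symm.injective hy'
    exact (congrArg ModuleCat.Hom.hom this).symm
  · rintro ⟨ψ, rfl⟩
    change Ψ _ = 0
    have : (ModuleCat.ofHom (ψ ∘ₗ f) : U.X₁ ⟶ Y) = U.f ≫ (ModuleCat.ofHom ψ : U.X₂ ⟶ Y) := rfl
    simp only [Ψ, this]
    rw [← Ext.mk₀_comp_mk₀, hU.extClass_comp_assoc, Ext.comp_zero]

end ExtDual

/-! ### Monomial ideals and the Hilbert-Burch complex -/

open MvPolynomial in
theorem MvPolynomial.mem_span_X_pow_image_iff {σ R : Type*} [CommSemiring R] {s : Set σ} {d : σ → ℕ}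
    {f : MvPolynomial σ R} :
    f ∈ Ideal.span ((fun i => (X i : MvPolynomial σ R) ^ d i) '' s) ↔
      ∀ m ∈ f.support, ∃ i ∈ s, d i ≤ m i := by
  have := mem_ideal_span_monomial_image (x := f) (s := (fun i => Finsupp.single i (d i)) '' s)
  simp only [Set.image_image, ← X_pow_eq_monomial] at this
  simp [this]

namespace HilbertBurch

open MvPolynomial

variable {K : Type u} [Field K]

section

variable (K) (a b : Fin 3 → ℕ)

/-- The entries of the first row of the relation matrix. -/
noncomputable def row₁ : Fin 3 → MvPolynomial (Fin 3) K := ![X 0 ^ a 0, X 1 ^ a 1, X 2 ^ a 2]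

/-- The entries of the second row of the relation matrix. -/
noncomputable def row₂ : Fin 3 → MvPolynomial (Fin 3) K := ![X 1 ^ b 1, X 2 ^ b 2, X 0 ^ b 0]

/-- The maximal minors of the relation matrix; the `i`-th one omits the column `i`. -/
noncomputable def minor : Fin 3 → MvPolynomial (Fin 3) K :=
  ![X 1 ^ a 1 * X 0 ^ b 0 - X 2 ^ a 2 * X 2 ^ b 2, X 0 ^ a 0 * X 0 ^ b 0 - X 2 ^ a 2 * X 1 ^ b 1,
    X 0 ^ a 0 * X 2 ^ b 2 - X 1 ^ a 1 * X 1 ^ b 1]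

@[simp] theorem row₁_zero : row₁ K a 0 = X 0 ^ a 0 := rfl
@[simp] theorem row₁_one : row₁ K a 1 = X 1 ^ a 1 := rfl
@[simp] theorem row₁_two : row₁ K a 2 = X 2 ^ a 2 := rfl
@[simp] theorem row₂_zero : row₂ K b 0 = X 1 ^ b 1 := rfl
@[simp] theorem row₂_one : row₂ K b 1 = X 2 ^ b 2 := rfl
@[simp] theorem row₂_two : row₂ K b 2 = X 0 ^ b 0 := rfl
@[simp] theorem minor_zero :
    minor K a b 0 = X 1 ^ a 1 * X 0 ^ b 0 - X 2 ^ a 2 * X 2 ^ b 2 := rfl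
@[simp] theorem minor_one :
    minor K a b 1 = X 0 ^ a 0 * X 0 ^ b 0 - X 2 ^ a 2 * X 1 ^ b 1 := rfl
@[simp] theorem minor_two :
    minor K a b 2 = X 0 ^ a 0 * X 2 ^ b 2 - X 1 ^ a 1 * X 1 ^ b 1 := rfl

/-- The ideal of maximal minors. -/
noncomputable def minorIdeal : Ideal (MvPolynomial (Fin 3) K) := Ideal.span (Set.range (minor K a b))

end

variable {a b : Fin 3 → ℕ}

theorem minor_mem (i : Fin 3) : minor K a b i ∈ minorIdeal K a b := Ideal.subset_span ⟨i, rfl⟩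

theorem mem_minorIdeal_iff {s : MvPolynomial (Fin 3) K} : s ∈ minorIdeal K a b ↔
    ∃ f g h, s = f * minor K a b 0 + g * minor K a b 1 + h * minor K a b 2 := by
  rw [minorIdeal, Ideal.mem_span_range_iff_exists_fun]
  constructor
  · rintro ⟨c, rfl⟩
    exact ⟨c 0, c 1, c 2, by rw [Fin.sum_univ_three]⟩
  · rintro ⟨f, g, h, rfl⟩
    exact ⟨![f, g, h], by rw [Fin.sum_univ_three]; rfl⟩

theorem row₁_mul_minor : row₁ K a 0 * minor K a b 0 =
    row₁ K a 1 * minor K a b 1 - row₁ K a 2 * minor K a b 2 := by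
  simp only [row₁_zero, row₁_one, row₁_two, minor_zero, minor_one, minor_two]
  ring

theorem row₂_mul_minor : row₂ K b 0 * minor K a b 0 =
    row₂ K b 1 * minor K a b 1 - row₂ K b 2 * minor K a b 2 := by
  simp only [row₂_zero, row₂_one, row₂_two, minor_zero, minor_one, minor_two]
  ring

theorem mem_span_pair_X_pow_iff {α β : ℕ} {f : MvPolynomial (Fin 3) K} :
    f ∈ Ideal.span {X 0 ^ α, X 1 ^ β} ↔ ∀ m ∈ f.support, α ≤ m 0 ∨ β ≤ m 1 := by
  have := mem_span_X_pow_image_iff (s := {0, 1}) (d := ![α, β, 0]) (f := f)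
  simpa [Set.image_pair] using this

/-- The first minor is regular modulo the first column. -/
theorem mem_of_mul_minor_mem (hb : 0 < b 0) {f : MvPolynomial (Fin 3) K} {β : ℕ}
    (h : f * minor K a b 0 ∈ Ideal.span {X 0 ^ a 0, X 1 ^ β}) :
    f ∈ Ideal.span {X 0 ^ a 0, X 1 ^ β} := by
  set J : Ideal (MvPolynomial (Fin 3) K) := Ideal.span {X 0 ^ a 0, X 1 ^ β}
  -- Modulo J the first term of the minor is nilpotent, so f kills a power of the second term. That
  -- is a power of `X 2`, a nonzerodivisor modulo a monomial ideal in `X 0` and `X 1`.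
  have hu : (X 1 ^ a 1 * X 0 ^ b 0 : MvPolynomial (Fin 3) K) ^ a 0 ∈ J := by
    have h0 : (X 0 ^ a 0 : MvPolynomial (Fin 3) K) ∈ J := Ideal.subset_span (by simp)
    refine Ideal.mem_of_dvd _ ?_ h0
    rw [mul_pow, ← pow_mul, ← pow_mul]
    exact Dvd.dvd.mul_left (pow_dvd_pow _ (Nat.le_mul_of_pos_left _ hb)) _
  obtain ⟨e, he⟩ := sub_dvd_pow_sub_pow (X 1 ^ a 1 * X 0 ^ b 0 : MvPolynomial (Fin 3) K)
    (X 2 ^ a 2 * X 2 ^ b 2) (a 0)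
  have hv : f * (X 2 ^ a 2 * X 2 ^ b 2) ^ a 0 ∈ J := by
    have : f * (X 2 ^ a 2 * X 2 ^ b 2) ^ a 0 =
        f * (X 1 ^ a 1 * X 0 ^ b 0) ^ a 0 - f * minor K a b 0 * e := by
      rw [minor_zero]
      linear_combination (-f) * he
    rw [this]
    exact J.sub_mem (J.mul_mem_left _ hu) (J.mul_mem_right _ h)
  rw [← pow_add, ← pow_mul, X_pow_eq_monomial, mem_span_pair_X_pow_iff] at hv
  rw [mem_span_pair_X_pow_iff]
  intro m hm
  have := hv (m + Finsupp.single 2 ((a 2 + b 2) * a 0)) (by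
    rw [mem_support_iff, coeff_mul_monomial, mul_one]
    exact mem_support_iff.mp hm)
  simpa using this

theorem not_X_dvd_X {i j : Fin 3} (hij : i ≠ j) : ¬ (X i : MvPolynomial (Fin 3) K) ∣ X j := by
  rintro ⟨e, he⟩
  have := congrArg (MvPolynomial.eval (Pi.single j (1 : K))) he
  simp [hij] at this

theorem isRelPrime_X_pow {i j : Fin 3} (hij : i ≠ j) (p q : ℕ) :
    IsRelPrime (X i ^ p : MvPolynomial (Fin 3) K) (X j ^ q) := by
  have h : IsRelPrime (X i : MvPolynomial (Fin 3) K) (X j) :=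
    (X_prime.irreducible.isRelPrime_iff_not_dvd).mpr (not_X_dvd_X hij)
  exact h.pow

theorem minor_one_ne_zero (hb : 0 < b 1) : minor K a b 1 ≠ 0 := by
  intro h
  have := congrArg (MvPolynomial.eval (Pi.single 0 (1 : K))) h
  simp [hb.ne'] at this

theorem minor_two_ne_zero (hb : 0 < b 2) : minor K a b 2 ≠ 0 := by
  intro h
  have := congrArg (MvPolynomial.eval (Pi.single 1 (1 : K))) h
  simp [hb.ne'] at this

/-- Setting `X 2 = 0` turns the two minors into pure powers of `X 0` and `X 1` up to sign. These are
coprime, so d becomes a unit; its constant term is unchanged. -/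
theorem constantCoeff_ne_zero_of_dvd (ha : ∀ i, 0 < a i) (hb : ∀ i, 0 < b i)
    {d : MvPolynomial (Fin 3) K} (h₁ : d ∣ minor K a b 1) (h₂ : d ∣ minor K a b 2) :
    constantCoeff d ≠ 0 := by
  let ρ : MvPolynomial (Fin 3) K →ₐ[K] MvPolynomial (Fin 3) K := aeval ![X 0, X 1, 0]
  have hρ : (constantCoeff (R := K) (σ := Fin 3)).comp ρ.toRingHom = constantCoeff := by
    refine MvPolynomial.ringHom_ext (fun r => by simp [ρ]) fun i => ?_
    fin_cases i <;> simp [ρ]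
  have e₁ : ρ d ∣ X 0 ^ (a 0 + b 0) := by
    have := map_dvd ρ h₁
    simpa [ρ, (ha 2).ne', ← pow_add] using this
  have e₂ : ρ d ∣ X 1 ^ (a 1 + b 1) := by
    have := map_dvd ρ h₂
    simpa [ρ, (hb 2).ne', ← pow_add] using this
  have hu : IsUnit (ρ d) := isRelPrime_X_pow (by decide) _ _ e₁ e₂
  have := hu.map (constantCoeff (R := K) (σ := Fin 3))
  rw [← hρ]
  exact this.ne_zero

/-- Such a d would divide the remaining minor too, hence all of I. A nonzero prime ideal of a UFD
contains a prime element, which would be associated to d; then d ∈ I has zero constant term, a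
contradiction. -/
theorem no_common_prime (ha : ∀ i, 0 < a i) (hb : ∀ i, 0 < b i) (hI : (minorIdeal K a b).IsPrime)
    (hI₀ : ∀ f ∈ minorIdeal K a b, constantCoeff f = 0) {d : MvPolynomial (Fin 3) K}
    (h₁ : d ∣ minor K a b 1) (h₂ : d ∣ minor K a b 2) : ¬ Prime d := by
  intro hd
  have hc := constantCoeff_ne_zero_of_dvd ha hb h₁ h₂
  have h₀ : d ∣ minor K a b 0 := by
    have : d ∣ row₁ K a 0 * minor K a b 0 := by
      rw [row₁_mul_minor]
      exact dvd_sub (h₁.mul_left _) (h₂.mul_left _)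
    refine (hd.dvd_or_dvd this).resolve_left fun hX => hc ?_
    have hX : d ∣ X 0 := hd.dvd_of_dvd_pow hX
    obtain ⟨e, he⟩ := (hd.irreducible.associated_of_dvd X_prime.irreducible hX).symm.dvd
    simp [he]
  have hne : minorIdeal K a b ≠ ⊥ := fun h =>
    minor_one_ne_zero (a := a) (K := K) (hb 1) ((Submodule.mem_bot _).mp (h ▸ minor_mem 1))
  obtain ⟨q, hq, hqp⟩ := hI.exists_mem_prime_of_ne_bot hne
  have hdq : d ∣ q := by
    obtain ⟨f, g, h, rfl⟩ := mem_minorIdeal_iff.mp hq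
    exact dvd_add (dvd_add (h₀.mul_left _) (h₁.mul_left _)) (h₂.mul_left _)
  exact hc (hI₀ d (Ideal.mem_of_dvd _
    (hd.irreducible.associated_of_dvd hqp.irreducible hdq).symm.dvd hq))

/-- Exactness of the Hilbert-Burch complex in the middle. -/
theorem exists_of_syzygy (ha : ∀ i, 0 < a i) (hb : ∀ i, 0 < b i) (hI : (minorIdeal K a b).IsPrime)
    (hI₀ : ∀ f ∈ minorIdeal K a b, constantCoeff f = 0) {f g h : MvPolynomial (Fin 3) K}
    (hs : f * minor K a b 0 - g * minor K a b 1 + h * minor K a b 2 = 0) :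
    ∃ u v, f = u * row₁ K a 0 + v * row₂ K b 0 ∧ g = u * row₁ K a 1 + v * row₂ K b 1 ∧
      h = u * row₁ K a 2 + v * row₂ K b 2 := by
  have hf : f ∈ Ideal.span {X 0 ^ a 0, X 1 ^ b 1} := by
    refine mem_of_mul_minor_mem (a := a) (hb 0) (Ideal.mem_span_pair.mpr
      ⟨g * X 0 ^ b 0 - h * X 2 ^ b 2, h * X 1 ^ a 1 - g * X 2 ^ a 2, ?_⟩)
    simp only [minor_one, minor_two] at hs
    linear_combination -hs
  obtain ⟨u, v, rfl⟩ := Ideal.mem_span_pair.mp hf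
  have r₁ := row₁_mul_minor (K := K) (a := a) (b := b)
  have r₂ := row₂_mul_minor (K := K) (a := a) (b := b)
  rw [row₁_zero] at r₁
  rw [row₂_zero] at r₂
  -- Subtracting u and v times the rows leaves a syzygy of two coprime minors, a multiple k of the
  -- Koszul one.
  have key : (g - u * row₁ K a 1 - v * row₂ K b 1) * minor K a b 1 =
      (h - u * row₁ K a 2 - v * row₂ K b 2) * minor K a b 2 := by
    linear_combination -hs + u * r₁ + v * r₂
  obtain ⟨k, hk⟩ : minor K a b 1 ∣ h - u * row₁ K a 2 - v * row₂ K b 2 :=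
    UniqueFactorizationMonoid.dvd_of_dvd_mul_left_of_no_prime_factors
      (minor_one_ne_zero (hb 1)) (fun d h₁ h₂ => no_common_prime ha hb hI hI₀ h₁ h₂)
      (Dvd.intro_left _ key)
  have hk' : g - u * row₁ K a 1 - v * row₂ K b 1 = k * minor K a b 2 := by
    rw [hk] at key
    exact mul_right_cancel₀ (minor_one_ne_zero (hb 1)) (by rw [key]; ring)
  -- The Koszul syzygy is itself a combination of the rows; its contributions cancel in the first
  -- column.
  refine ⟨u - k * X 1 ^ b 1, v + k * X 0 ^ a 0, ?_, ?_, ?_⟩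
  · simp only [row₁_zero, row₂_zero]
    ring
  · simp only [row₁_one, row₂_one, minor_two] at hk' ⊢
    linear_combination hk'
  · simp only [row₁_two, row₂_two, minor_one] at hk ⊢
    linear_combination hk

/-- Cramer's rule: the determinant of the first two columns is a nonzero minor. -/
theorem eq_zero_of_columns (hb : 0 < b 2) {u v : MvPolynomial (Fin 3) K}
    (h₀ : u * row₁ K a 0 + v * row₂ K b 0 = 0) (h₁ : u * row₁ K a 1 + v * row₂ K b 1 = 0) :
    u = 0 ∧ v = 0 := by
  simp only [row₁_zero, row₂_zero, row₁_one, row₂_one] at h₀ h₁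
  constructor <;> refine (mul_eq_zero.mp ?_).resolve_right (minor_two_ne_zero (a := a) hb) <;>
    rw [minor_two]
  · linear_combination X 2 ^ b 2 * h₀ - X 1 ^ b 1 * h₁
  · linear_combination X 0 ^ a 0 * h₁ - X 1 ^ a 1 * h₀

/-- Over the quotient by the minors, a solution of the linear equation with coefficients the
first column has entries in the ideals generated by the rows. -/
theorem exists_of_column_mem (hb : 0 < b 0) {U V : MvPolynomial (Fin 3) K}
    (h : U * row₁ K a 0 + V * row₂ K b 0 ∈ minorIdeal K a b) :
    U ∈ Ideal.span (Set.range fun i => (X i : MvPolynomial (Fin 3) K) ^ b i) ∧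
      V ∈ Ideal.span (Set.range fun i => (X i : MvPolynomial (Fin 3) K) ^ a i) := by
  obtain ⟨f, g, h, e⟩ := mem_minorIdeal_iff.mp h
  have hf : f ∈ Ideal.span {X 0 ^ a 0, X 1 ^ b 1} := by
    refine mem_of_mul_minor_mem (a := a) hb (Ideal.mem_span_pair.mpr
      ⟨U - g * X 0 ^ b 0 - h * X 2 ^ b 2, V + h * X 1 ^ a 1 + g * X 2 ^ a 2, ?_⟩)
    simp only [minor_one, minor_two, row₁_zero, row₂_zero] at e
    linear_combination e
  obtain ⟨u, v, rfl⟩ := Ideal.mem_span_pair.mp hf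
  -- The row relations trade the first minor for the other two, which absorbs f. The rest is a
  -- syzygy of the coprime powers `X 0 ^ a 0` and `X 1 ^ b 1`.
  set g' := g + u * X 1 ^ a 1 + v * X 2 ^ b 2 with hg'
  set h' := h - u * X 2 ^ a 2 - v * X 0 ^ b 0 with hh'
  have key : X 0 ^ a 0 * (U - g' * X 0 ^ b 0 - h' * X 2 ^ b 2) =
      X 1 ^ b 1 * (-V - g' * X 2 ^ a 2 - h' * X 1 ^ a 1) := by
    simp only [minor_zero, minor_one, minor_two, row₁_zero, row₂_zero] at e
    rw [hg', hh']
    linear_combination e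
  obtain ⟨k, hk⟩ : X 1 ^ b 1 ∣ U - g' * X 0 ^ b 0 - h' * X 2 ^ b 2 :=
    (isRelPrime_X_pow (by decide : (1 : Fin 3) ≠ 0) _ _).dvd_of_dvd_mul_left (Dvd.intro _ key.symm)
  have hk' : -V - g' * X 2 ^ a 2 - h' * X 1 ^ a 1 = X 0 ^ a 0 * k := by
    rw [hk] at key
    exact mul_left_cancel₀ (pow_ne_zero (b 1) (X_ne_zero (1 : Fin 3))) (by rw [← key]; ring)
  rw [Ideal.mem_span_range_iff_exists_fun, Ideal.mem_span_range_iff_exists_fun]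
  refine ⟨⟨![g', k, h'], ?_⟩, ⟨![-k, -h', -g'], ?_⟩⟩ <;> simp only [Fin.sum_univ_three,
    Matrix.cons_val]
  · linear_combination -hk
  · linear_combination hk'

end HilbertBurch

/-! ### The trace of a module with two generators -/

section Trace

variable {R M : Type*} [CommRing R] [AddCommGroup M] [Module R M]

theorem exists_linearMap_of_two_generators {p q : M} (hgen : ∀ m, ∃ r s : R, m = r • p + s • q)
    {P Q : R} (h : ∀ r s : R, r • p + s • q = 0 → r * P + s * Q = 0) :
    ∃ φ : M →ₗ[R] R, φ p = P ∧ φ q = Q := by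
  let θ : R × R →ₗ[R] M := (LinearMap.toSpanSingleton R M p).coprod (LinearMap.toSpanSingleton R M q)
  let η : R × R →ₗ[R] R := (LinearMap.toSpanSingleton R R P).coprod (LinearMap.toSpanSingleton R R Q)
  have hθ : Function.Surjective θ := fun m => by
    obtain ⟨r, s, rfl⟩ := hgen m
    exact ⟨(r, s), by simp [θ]⟩
  have hker : LinearMap.ker θ ≤ LinearMap.ker η := by
    rintro ⟨r, s⟩ hrs
    simpa [η] using h r s (by simpa [θ] using hrs)
  let φ := (LinearMap.ker θ).liftQ η hker ∘ₗ (θ.quotKerEquivOfSurjective hθ).symm.toLinearMap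
  have hφ : ∀ x, φ (θ x) = η x := fun x => by
    have : (θ.quotKerEquivOfSurjective hθ).symm (θ x) = (LinearMap.ker θ).mkQ x := by
      rw [LinearEquiv.symm_apply_eq]
      rfl
    simp [φ, this]
  refine ⟨φ, ?_, ?_⟩
  · simpa [θ, η] using hφ (1, 0)
  · simpa [θ, η] using hφ (0, 1)

theorem moduleTrace_le_of_two_generators {p q : M} (hgen : ∀ m, ∃ r s : R, m = r • p + s • q)
    {J : Ideal R} (h : ∀ φ : M →ₗ[R] R, φ p ∈ J ∧ φ q ∈ J) : moduleTrace R M ≤ J := by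
  refine iSup_le fun φ => ?_
  rintro _ ⟨m, rfl⟩
  obtain ⟨r, s, rfl⟩ := hgen m
  rw [map_add, map_smul, map_smul]
  exact J.add_mem (J.mul_mem_left _ (h φ).1) (J.mul_mem_left _ (h φ).2)

theorem apply_mem_moduleTrace (φ : M →ₗ[R] R) (m : M) : φ m ∈ moduleTrace R M :=
  (le_iSup (fun φ : M →ₗ[R] R => LinearMap.range φ) φ : _) ⟨m, rfl⟩

end Trace

/-! ### The dimension of a quotient by powers of the variables -/

/-- The map reads off the coefficients of the monomials with all exponents below d; the other
monomials span the ideal. -/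
theorem MvPolynomial.exists_linearMap_ker_eq_span_X_pow (K σ : Type*) [Field K] [Fintype σ]
    [DecidableEq σ] (d : σ → ℕ) :
    ∃ L : MvPolynomial σ K →ₗ[K] ((∀ i, Fin (d i)) → K), Function.Surjective L ∧
      ∀ f, L f = 0 ↔ f ∈ Ideal.span (Set.range fun i => (X i : MvPolynomial σ K) ^ d i) := by
  let e : (∀ i, Fin (d i)) → σ →₀ ℕ := fun k => Finsupp.equivFunOnFinite.symm fun i => (k i : ℕ)
  have he : Function.Injective e := fun k l h => by
    funext i
    exact Fin.ext (DFunLike.congr_fun h i)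
  refine ⟨LinearMap.pi fun k => lcoeff K (e k), fun v => ⟨∑ k, monomial (e k) (v k), ?_⟩,
    fun f => ?_⟩
  · funext l
    simp [coeff_monomial, he.eq_iff]
  · rw [← Set.image_univ, mem_span_X_pow_image_iff]
    simp only [Set.mem_univ, true_and]
    constructor
    · intro h m hm
      by_contra! hc
      refine mem_support_iff.mp hm ?_
      have := congrFun h fun i => ⟨m i, hc i⟩
      have hem : e (fun i => ⟨m i, hc i⟩) = m := by
        ext i
        rfl
      simpa [hem] using this
    · intro h
      funext k
      by_contra hc
      obtain ⟨i, hi⟩ := h (e k) (mem_support_iff.mpr hc)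
      exact absurd hi (not_le.mpr (k i).2)

theorem rank_quotient_eq_of_ker_eq {K V A : Type u} {ι : Type} [Field K] [AddCommGroup V]
    [Module K V] [AddCommGroup A] [Module K A] [Fintype ι] (f : V →ₗ[K] A)
    (hf : Function.Surjective f) (L : V →ₗ[K] (ι → K)) (hL : Function.Surjective L)
    (h : ∀ v, f v = 0 ↔ L v = 0) : Module.rank K A = (Fintype.card ι : Cardinal.{u}) := by
  have hker : LinearMap.ker f = LinearMap.ker L := by
    ext v
    exact h v
  have e := (f.quotKerEquivOfSurjective hf).symm.trans
    ((Submodule.quotEquivOfEq _ _ hker).trans (L.quotKerEquivOfSurjective hL))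
  rw [e.rank_eq, rank_fun']

/-! ### The defining ideal of the semigroup ring -/

namespace NumSemigroup

open MvPolynomial HilbertBurch

theorem algebraMap_surjective (K : Type u) [Field K] {e : ℕ} (n : Fin e → ℕ) :
    Function.Surjective (algebraMap (MvPolynomial (Fin e) K) (semigroupRing K n)) := by
  rintro ⟨x, hx⟩
  rw [semigroupRing, Algebra.adjoin_range_eq_range_aeval] at hx
  obtain ⟨f, rfl⟩ := hx
  refine ⟨f, Subtype.ext ?_⟩
  change (semigroupRing K n).val (aeval (t K n) f) = _
  rw [← AlgHom.comp_apply, comp_aeval]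
  rfl

theorem coe_algebraMap {K : Type u} [Field K] {e : ℕ} {n : Fin e → ℕ} (f : MvPolynomial (Fin e) K) :
    (algebraMap (MvPolynomial (Fin e) K) (semigroupRing K n) f : Polynomial K) =
      aeval (fun i => (Polynomial.X : Polynomial K) ^ n i) f := by
  change (semigroupRing K n).val (aeval (t K n) f) = _
  rw [← AlgHom.comp_apply, comp_aeval]
  rfl

theorem algebraMap_X {K : Type u} [Field K] {e : ℕ} {n : Fin e → ℕ} (i : Fin e) :
    algebraMap (MvPolynomial (Fin e) K) (semigroupRing K n) (X i) = t K n i :=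
  aeval_X _ _

/-- An ideal identifying all monomials of equal weight contains the kernel of the monomial
parametrization `x_i ↦ t ^ n_i`. -/
theorem mem_of_aeval_eq_zero {K : Type u} [Field K] {e : ℕ} {n : Fin e → ℕ}
    {J : Ideal (MvPolynomial (Fin e) K)}
    (hJ : ∀ m m' : Fin e →₀ ℕ, ∑ i, m i * n i = ∑ i, m' i * n i →
      Ideal.Quotient.mk J (monomial m 1) = Ideal.Quotient.mk J (monomial m' 1))
    {f : MvPolynomial (Fin e) K}
    (hf : aeval (fun i => (Polynomial.X : Polynomial K) ^ n i) f = 0) : f ∈ J := by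
  classical
  let w : (Fin e →₀ ℕ) → ℕ := fun m => ∑ i, m i * n i
  -- θ sends t^k to the class of a chosen monomial of weight k (an irrelevant one if none exists).
  -- Thus the quotient map modulo J factors through the parametrization.
  let θ : Polynomial K →ₗ[K] MvPolynomial (Fin e) K ⧸ J :=
    (Polynomial.basisMonomials K).constr K fun k =>
      Ideal.Quotient.mk J (monomial (Function.invFun w k) 1)
  have hθ : ∀ k, θ (Polynomial.X ^ k) =
      Ideal.Quotient.mk J (monomial (Function.invFun w k) 1) := fun k => by
    have := (Polynomial.basisMonomials K).constr_basis K (fun k =>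
      Ideal.Quotient.mk J (monomial (Function.invFun w k) 1)) k
    simpa only [Polynomial.coe_basisMonomials, ← Polynomial.X_pow_eq_monomial] using this
  have hcomp : θ ∘ₗ (aeval (fun i => (Polynomial.X : Polynomial K) ^ n i)).toLinearMap =
      (Ideal.Quotient.mkₐ K J).toLinearMap := by
    refine (MvPolynomial.basisMonomials (Fin e) K).ext fun m => ?_
    have hm : aeval (fun i => (Polynomial.X : Polynomial K) ^ n i) (monomial m (1 : K)) =
        Polynomial.X ^ w m := by
      rw [aeval_monomial, map_one, one_mul, Finsupp.prod_fintype _ _ (by simp),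
        ← Finset.prod_pow_eq_pow_sum]
      exact Finset.prod_congr rfl fun i _ => by rw [← pow_mul, mul_comm]
    simp only [coe_basisMonomials, LinearMap.comp_apply, AlgHom.toLinearMap_apply, hm, hθ]
    exact hJ _ _ (Function.invFun_eq (f := w) ⟨m, rfl⟩)
  have := LinearMap.congr_fun hcomp f
  rw [LinearMap.comp_apply, AlgHom.toLinearMap_apply, hf, map_zero] at this
  exact Ideal.Quotient.eq_zero_iff_mem.mp this.symm

variable {K : Type u} [Field K] {n a b c : Fin 3 → ℕ}

/-- Herzog's theorem: the defining ideal of a non-symmetric semigroup with three generators is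
generated by the maximal minors of the relation matrix. -/
theorem IsStructureData.algebraMap_eq_zero_iff (h : IsStructureData n a b c) (hn : ∀ i, 0 < n i)
    (ha : ∀ i, 0 < a i) (hb : ∀ i, 0 < b i) (f : MvPolynomial (Fin 3) K) :
    algebraMap (MvPolynomial (Fin 3) K) (semigroupRing K n) f = 0 ↔ f ∈ minorIdeal K a b := by
  have hc := h.c_eq hn ha hb
  have e₁ := h.eq₁
  have e₂ := h.eq₂
  have e₃ := h.eq₃
  have hz : algebraMap (MvPolynomial (Fin 3) K) (semigroupRing K n) f = 0 ↔
      aeval (fun i => (Polynomial.X : Polynomial K) ^ n i) f = 0 := by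
    rw [← coe_algebraMap, ZeroMemClass.coe_eq_zero]
  rw [hz]
  refine ⟨mem_of_aeval_eq_zero fun m m' hw => ?_, fun hf => ?_⟩
  · set π := Ideal.Quotient.mk (minorIdeal K a b)
    have hπ : ∀ i, π (minor K a b i) = 0 := fun i => Ideal.Quotient.eq_zero_iff_mem.mpr (minor_mem i)
    have r₁ := hπ 1
    have r₂ := hπ 2
    have r₃ := hπ 0
    simp only [minor_zero, minor_one, minor_two, map_sub, map_mul, map_pow, ← pow_add,
      ← hc] at r₁ r₂ r₃
    have hmon : ∀ m : Fin 3 →₀ ℕ, π (monomial m 1) = π (X 0) ^ m 0 * π (X 1) ^ m 1 * π (X 2) ^ m 2 :=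
      fun m => by
        rw [monomial_eq, Finsupp.prod_fintype _ _ (by simp), Fin.prod_univ_three]
        simp
    have hred := fun m : Fin 3 →₀ ℕ => exists_isReduced (x := π (X 0)) (y := π (X 1)) (z := π (X 2))
      (hn 0) (hn 2) (ha 2) (hb 0) (hb 2) e₁ e₂ e₃ (by linear_combination r₁)
      (by linear_combination -r₂) (by linear_combination -r₃) _ (m 0) (m 1) (m 2) le_rfl
    obtain ⟨p, q, r, h₁, hw₁, he₁⟩ := hred m
    obtain ⟨p', q', r', h₂, hw₂, he₂⟩ := hred m'
    rw [Fin.sum_univ_three, Fin.sum_univ_three] at hw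
    obtain ⟨rfl, rfl, rfl⟩ := h₁.eq_of_weight_eq (hn 0) (hn 1) (hn 2) h.minRel₁ h.minRel₂ h.minRel₃
      e₃ h₂ (hw₁.symm.trans (hw.trans hw₂))
    rw [hmon, hmon, he₁, he₂]
  · have hle : minorIdeal K a b ≤
        RingHom.ker (aeval (R := K) fun i => (Polynomial.X : Polynomial K) ^ n i) := by
      rw [minorIdeal, Ideal.span_le]
      rintro _ ⟨i, rfl⟩
      rw [SetLike.mem_coe, RingHom.mem_ker]
      rw [hc] at e₁ e₂ e₃
      fin_cases i <;> simp only [Fin.zero_eta, Fin.mk_one, Fin.reduceFinMk, minor_zero, minor_one,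
        minor_two, map_sub, map_mul, map_pow, aeval_X, ← pow_mul, ← pow_add, sub_eq_zero] <;>
        congr 1 <;> linarith
    exact hle hf

theorem IsStructureData.minorIdeal_isPrime (h : IsStructureData n a b c) (hn : ∀ i, 0 < n i)
    (ha : ∀ i, 0 < a i) (hb : ∀ i, 0 < b i) : (minorIdeal K a b).IsPrime := by
  have : minorIdeal K a b = RingHom.ker (algebraMap (MvPolynomial (Fin 3) K) (semigroupRing K n)) := by
    ext f
    exact (h.algebraMap_eq_zero_iff hn ha hb f).symm
  rw [this]
  exact RingHom.ker_isPrime _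

/-- Evaluate at t = 0, where all t^(n_i) vanish. -/
theorem IsStructureData.constantCoeff_eq_zero (h : IsStructureData n a b c) (hn : ∀ i, 0 < n i)
    (ha : ∀ i, 0 < a i) (hb : ∀ i, 0 < b i) (f : MvPolynomial (Fin 3) K)
    (hf : f ∈ minorIdeal K a b) : constantCoeff f = 0 := by
  have h0 := (h.algebraMap_eq_zero_iff (K := K) hn ha hb f).mpr hf
  have h1 := congrArg (fun x : semigroupRing K n => Polynomial.aeval (0 : K) (x : Polynomial K)) h0
  simp only [coe_algebraMap, ZeroMemClass.coe_zero, map_zero] at h1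
  rw [← AlgHom.comp_apply, comp_aeval] at h1
  simpa [(hn _).ne', ← constantCoeff_eq] using h1

/-! ### The canonical module -/

/-- The canonical module is generated by two elements, with the columns of the relation matrix as
relations. -/
theorem IsStructureData.exists_generators (h : IsStructureData n a b c) (hn : ∀ i, 0 < n i)
    (ha : ∀ i, 0 < a i) (hb : ∀ i, 0 < b i) :
    ∃ p q : CanonicalModule K n,
      (∀ m, ∃ r s : semigroupRing K n, m = r • p + s • q) ∧
      (∀ i, algebraMap _ (semigroupRing K n) (row₁ K a i) • p +
        algebraMap _ (semigroupRing K n) (row₂ K b i) • q = 0) ∧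
      ∀ r s : semigroupRing K n, r • p + s • q = 0 → ∃ z : Fin 3 → semigroupRing K n,
        r = ∑ i, z i * algebraMap _ (semigroupRing K n) (row₁ K a i) ∧
        s = ∑ i, z i * algebraMap _ (semigroupRing K n) (row₂ K b i) := by
  set S := MvPolynomial (Fin 3) K
  set R := semigroupRing K n
  let f : S × S →ₗ[S] (Fin 3 → S) := LinearMap.pi fun i =>
    (LinearMap.toSpanSingleton S S (row₁ K a i)).coprod (LinearMap.toSpanSingleton S S (row₂ K b i))
  have hf_apply : ∀ u v i, f (u, v) i = u * row₁ K a i + v * row₂ K b i := fun u v i => by simp [f]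
  let g : (Fin 3 → S) →ₗ[S] S := minor K a b 0 • LinearMap.proj 0 - minor K a b 1 • LinearMap.proj 1 +
    minor K a b 2 • LinearMap.proj 2
  have hg_apply : ∀ z, g z = z 0 * minor K a b 0 - z 1 * minor K a b 1 + z 2 * minor K a b 2 :=
    fun z => by simp [g, mul_comm]
  have hf : Function.Injective f := by
    rw [injective_iff_map_eq_zero]
    rintro ⟨u, v⟩ huv
    obtain ⟨rfl, rfl⟩ := eq_zero_of_columns (K := K) (a := a) (hb 2)
      ((hf_apply u v 0).symm.trans (congrFun huv 0)) ((hf_apply u v 1).symm.trans (congrFun huv 1))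
    rfl
  have hfg : Function.Exact f g := by
    intro z
    rw [hg_apply]
    constructor
    · intro hz
      obtain ⟨u, v, h0, h1, h2⟩ := exists_of_syzygy ha hb (h.minorIdeal_isPrime hn ha hb)
        (h.constantCoeff_eq_zero hn ha hb) hz
      refine ⟨(u, v), funext fun i => ?_⟩
      fin_cases i
      exacts [(hf_apply u v 0).trans h0.symm, (hf_apply u v 1).trans h1.symm,
        (hf_apply u v 2).trans h2.symm]
    · rintro ⟨⟨u, v⟩, rfl⟩
      rw [hf_apply, hf_apply, hf_apply]
      linear_combination u * row₁_mul_minor (K := K) (a := a) (b := b) +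
        v * row₂_mul_minor (K := K) (a := a) (b := b)
  have hg : ∀ s, algebraMap S R s = 0 ↔ s ∈ LinearMap.range g := by
    intro s
    rw [h.algebraMap_eq_zero_iff hn ha hb, mem_minorIdeal_iff]
    constructor
    · rintro ⟨x, y, z, rfl⟩
      exact ⟨![x, -y, z], by rw [hg_apply]; simp only [Matrix.cons_val]; ring⟩
    · rintro ⟨z, rfl⟩
      exact ⟨z 0, -z 1, z 2, by rw [hg_apply]; ring⟩
  obtain ⟨Ψ, hΨ, hΨs, hΨ0⟩ := ExtDual.exists_presentation f g hf hfg hg (algebraMap_surjective K n)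
  have hcomb : ∀ u v : S, Ψ (u • LinearMap.fst S S S + v • LinearMap.snd S S S) =
      algebraMap S R u • Ψ (LinearMap.fst S S S) + algebraMap S R v • Ψ (LinearMap.snd S S S) :=
    fun u v => by rw [map_add, hΨs, hΨs]
  refine ⟨Ψ (LinearMap.fst S S S), Ψ (LinearMap.snd S S S), fun m => ?_, fun i => ?_,
    fun r s hrs => ?_⟩
  · obtain ⟨φ, rfl⟩ := hΨ m
    refine ⟨algebraMap S R (φ (1, 0)), algebraMap S R (φ (0, 1)), ?_⟩
    rw [← hcomb]
    congr 1
    ext <;> simp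
  · rw [← hcomb, hΨ0]
    refine ⟨LinearMap.proj i, ?_⟩
    ext <;> simp [f]
  · obtain ⟨u, rfl⟩ := algebraMap_surjective K n r
    obtain ⟨v, rfl⟩ := algebraMap_surjective K n s
    rw [← hcomb, hΨ0] at hrs
    obtain ⟨ψ, hψ⟩ := hrs
    have hψ_apply : ∀ w, ψ w = ∑ i, ψ (Pi.single i 1) * w i := fun w => by
      conv_lhs => rw [pi_eq_sum_univ' w]
      simp [mul_comm]
    have hu : u = ∑ i, ψ (Pi.single i 1) * row₁ K a i := by
      have := LinearMap.congr_fun hψ (1, 0)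
      simpa [hψ_apply (f (1, 0)), hf_apply] using this
    have hv : v = ∑ i, ψ (Pi.single i 1) * row₂ K b i := by
      have := LinearMap.congr_fun hψ (0, 1)
      simpa [hψ_apply (f (0, 1)), hf_apply] using this
    refine ⟨fun i => algebraMap S R (ψ (Pi.single i 1)), ?_, ?_⟩
    · conv_lhs => rw [hu]
      simp only [map_sum, map_mul]
      rfl
    · conv_lhs => rw [hv]
      simp only [map_sum, map_mul]
      rfl

/-! ### The trace ideal and the residue -/

theorem IsStructureData.canonicalTrace_eq (h : IsStructureData n a b c) (hn : ∀ i, 0 < n i)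
    (ha : ∀ i, 0 < a i) (hb : ∀ i, 0 < b i) {d : Fin 3 → ℕ} (hd : ∀ i, d i = min (a i) (b i)) :
    canonicalTrace K n = Ideal.span (Set.range fun i => t K n i ^ d i) := by
  obtain ⟨p, q, hgen, hrel, hker⟩ := h.exists_generators (K := K) hn ha hb
  apply le_antisymm
  · refine moduleTrace_le_of_two_generators hgen fun φ => ?_
    obtain ⟨U, hU⟩ := algebraMap_surjective K n (φ p)
    obtain ⟨V, hV⟩ := algebraMap_surjective K n (φ q)
    have hmem : U * row₁ K a 0 + V * row₂ K b 0 ∈ minorIdeal K a b := by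
      rw [← h.algebraMap_eq_zero_iff hn ha hb, map_add, map_mul, map_mul, hU, hV]
      have := congrArg φ (hrel 0)
      rw [map_add, map_smul, map_smul, map_zero, smul_eq_mul, smul_eq_mul] at this
      linear_combination this
    have key : ∀ e : Fin 3 → ℕ, (∀ i, d i ≤ e i) → ∀ W : MvPolynomial (Fin 3) K,
        W ∈ Ideal.span (Set.range fun i => (X i : MvPolynomial (Fin 3) K) ^ e i) →
        algebraMap _ (semigroupRing K n) W ∈ Ideal.span (Set.range fun i => t K n i ^ d i) := by
      intro e he W hW
      have := Ideal.mem_map_of_mem (algebraMap _ (semigroupRing K n)) hW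
      rw [Ideal.map_span] at this
      refine Ideal.span_le.mpr ?_ this
      rintro _ ⟨_, ⟨i, rfl⟩, rfl⟩
      rw [map_pow, algebraMap_X]
      exact Ideal.mem_of_dvd _ (pow_dvd_pow _ (he i)) (Ideal.subset_span ⟨i, rfl⟩)
    obtain ⟨hU', hV'⟩ := exists_of_column_mem (hb 0) hmem
    rw [← hU, ← hV]
    exact ⟨key b (fun i => (hd i).trans_le (min_le_right _ _)) U hU',
      key a (fun i => (hd i).trans_le (min_le_left _ _)) V hV'⟩
  · have hrow : ∀ i j, row₁ K a i * row₂ K b j - row₂ K b i * row₁ K a j ∈ minorIdeal K a b := by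
      have h0 := minor_mem (K := K) (a := a) (b := b) 0
      have h1 := minor_mem (K := K) (a := a) (b := b) 1
      have h2 := minor_mem (K := K) (a := a) (b := b) 2
      have hlt : ∀ i j, i < j →
          row₁ K a i * row₂ K b j - row₂ K b i * row₁ K a j ∈ minorIdeal K a b := by
        intro i j hij
        fin_cases i <;> fin_cases j <;> first
          | exact absurd hij (by decide)
          | (convert h0 using 1; simp; ring1)
          | (convert h1 using 1; simp; ring1)
          | (convert h2 using 1; simp; ring1)
      intro i j
      rcases lt_trichotomy i j with hij | rfl | hij
      · exact hlt i j hij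
      · convert (minorIdeal K a b).zero_mem using 1
        ring
      · convert (minorIdeal K a b).neg_mem (hlt j i hij) using 1
        ring
    have hφ : ∀ j, ∃ φ : CanonicalModule K n →ₗ[semigroupRing K n] semigroupRing K n,
        φ p = algebraMap _ _ (row₂ K b j) ∧ φ q = -algebraMap _ _ (row₁ K a j) := by
      intro j
      refine exists_linearMap_of_two_generators hgen fun r s hrs => ?_
      obtain ⟨z, rfl, rfl⟩ := hker r s hrs
      rw [Finset.sum_mul, Finset.sum_mul, ← Finset.sum_add_distrib]
      refine Finset.sum_eq_zero fun i _ => ?_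
      have := (h.algebraMap_eq_zero_iff (K := K) hn ha hb _).mpr (hrow i j)
      rw [map_sub, map_mul, map_mul] at this
      linear_combination z i * this
    have h₂ : ∀ j, algebraMap _ _ (row₂ K b j) ∈ canonicalTrace K n := fun j => by
      obtain ⟨φ, hp, -⟩ := hφ j
      exact hp ▸ apply_mem_moduleTrace φ p
    have h₁ : ∀ j, algebraMap _ _ (row₁ K a j) ∈ canonicalTrace K n := fun j => by
      obtain ⟨φ, -, hq⟩ := hφ j
      rw [← neg_mem_iff, ← hq]
      exact apply_mem_moduleTrace φ q
    rw [Ideal.span_le]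
    rintro _ ⟨i, rfl⟩
    change t K n i ^ d i ∈ canonicalTrace K n
    rw [hd, ← algebraMap_X, ← map_pow]
    rcases min_choice (a i) (b i) with hm | hm <;> rw [hm] <;> fin_cases i
    -- The second row is cyclically shifted, hence the indices 2, 0, 1.
    exacts [h₁ 0, h₁ 1, h₁ 2, h₂ 2, h₂ 0, h₂ 1]

/-- Every term of a minor is divisible by some `X i ^ d i`, so I ⊆ D and the quotient of R by the
trace is S / D. -/
theorem IsStructureData.residue_eq (h : IsStructureData n a b c) (hn : ∀ i, 0 < n i)
    (ha : ∀ i, 0 < a i) (hb : ∀ i, 0 < b i) {d : Fin 3 → ℕ} (hd : ∀ i, d i = min (a i) (b i)) :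
    residue K n = ((d 0 * d 1 * d 2 : ℕ) : Cardinal.{u}) := by
  obtain ⟨L, hL, hL0⟩ := MvPolynomial.exists_linearMap_ker_eq_span_X_pow K (Fin 3) d
  let F : MvPolynomial (Fin 3) K →ₗ[K] (semigroupRing K n ⧸ canonicalTrace K n) :=
    (Ideal.Quotient.mkₐ K (canonicalTrace K n)).toLinearMap ∘ₗ (aeval (t K n)).toLinearMap
  have hF : Function.Surjective F :=
    (Ideal.Quotient.mk_surjective (I := canonicalTrace K n)).comp (algebraMap_surjective K n)
  have := rank_quotient_eq_of_ker_eq F hF L hL fun f => ?_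
  · rw [residue, this, Fintype.card_pi, Fin.prod_univ_three]
    simp
  rw [hL0]
  set D := Ideal.span (Set.range fun i => (X i : MvPolynomial (Fin 3) K) ^ d i) with hD
  have hmap : canonicalTrace K n = D.map (algebraMap _ (semigroupRing K n)) := by
    rw [h.canonicalTrace_eq hn ha hb hd, hD, Ideal.map_span, ← Set.range_comp]
    congr 2
    funext i
    rw [Function.comp_apply, map_pow, algebraMap_X]
  have hker : minorIdeal K a b ≤ D := by
    have hmem : ∀ i e, d i ≤ e → (X i : MvPolynomial (Fin 3) K) ^ e ∈ D := fun i e he =>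
      Ideal.mem_of_dvd _ (pow_dvd_pow _ he) (Ideal.subset_span ⟨i, rfl⟩)
    have hA : ∀ i, (X i : MvPolynomial (Fin 3) K) ^ a i ∈ D := fun i =>
      hmem i _ ((hd i).trans_le (min_le_left _ _))
    rw [minorIdeal, Ideal.span_le]
    rintro _ ⟨i, rfl⟩
    fin_cases i
    exacts [D.sub_mem (D.mul_mem_right _ (hA 1)) (D.mul_mem_right _ (hA 2)),
      D.sub_mem (D.mul_mem_right _ (hA 0)) (D.mul_mem_right _ (hA 2)),
      D.sub_mem (D.mul_mem_right _ (hA 0)) (D.mul_mem_right _ (hA 1))]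
  have hF0 : F f = 0 ↔ algebraMap _ (semigroupRing K n) f ∈ canonicalTrace K n :=
    Ideal.Quotient.eq_zero_iff_mem
  rw [hF0, hmap, Ideal.mem_map_iff_of_surjective _ (algebraMap_surjective K n)]
  refine ⟨fun ⟨x, hx, e⟩ => ?_, fun hf => ⟨f, hf, rfl⟩⟩
  have : f - x ∈ D := hker ((h.algebraMap_eq_zero_iff hn ha hb _).mp (by rw [map_sub, e, sub_self]))
  simpa using D.add_mem this hx

end NumSemigroup

theorem mainTheorem10 (K : Type u) [Field K] (n : Fin 3 → ℕ)
    (hnum : NumSemigroup.IsNumerical (NumSemigroup.gen n))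
    (hmin : NumSemigroup.IsMinimalGen n)
    (hns : ¬ NumSemigroup.IsSymmetric (NumSemigroup.gen n))
    (a b c d : Fin 3 → ℕ) (habc : NumSemigroup.IsStructureData n a b c)
    (hd : ∀ i, d i = min (a i) (b i)) :
    NumSemigroup.canonicalTrace K n =
        Ideal.span {NumSemigroup.t K n 0 ^ d 0, NumSemigroup.t K n 1 ^ d 1,
          NumSemigroup.t K n 2 ^ d 2} ∧
      NumSemigroup.residue K n = ((d 0 * d 1 * d 2 : ℕ) : Cardinal.{u}) := by
  obtain ⟨ha, hb⟩ := habc.pos hnum hmin.pos hns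
  refine ⟨(habc.canonicalTrace_eq hmin.pos ha hb hd).trans (congrArg Ideal.span ?_),
    habc.residue_eq hmin.pos ha hb hd⟩
  ext x
  simp [Fin.exists_fin_succ, eq_comm]
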